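/- Let $\varphi(r)=r^2\log r$ for $r>0$, $\varphi(0)=0$, be the thin-plate spline radial basis function, and for $j\in\mathbb{Z}$ let $$\lambda_j=\frac1{2\pi}\int_{-\pi}^{\pi}(2-2\cos\theta)^{3/2}\,e^{-ij\theta}\,d\theta$$ be the Fourier coefficients of $(2-2\cos\theta)^{3/2}$ (these are real numbers). Then for every $x\in\mathbb{R}$ the series defining the (normalised) quasi-Lagrange function $$\psi(x)=\frac1{2\pi}\sum_{j\in\mathbb{Z}}\lambda_j\,\varphi(|x-j|),\qquad x\in\mathbb{R},$$ converges absolutely, and the quasi-interpolation with $\psi$ is exact for linear polynomials: for every real polynomial $p$ of degree at most $1$ and every $x\in\mathbb{R}$, $$\sum_{k\in\mathbb{Z}}p(k)\,\psi(x-k)=p(x),$$ where the series converges absolutely. -/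

import Mathlib

open Polynomial

/-- The thin-plate spline radial basis function `φ(r) = r² log r`, with `φ(0) = 0`
(its continuous value, which is what `Real.log 0 = 0` gives). -/
noncomputable def thinPlateSpline (r : ℝ) : ℝ := r ^ 2 * Real.log r

/-- The `2π`-periodic symbol `θ ↦ (2 - 2 cos θ)^{3/2}`. -/
noncomputable def oddSymbol (θ : ℝ) : ℝ := (2 - 2 * Real.cos θ) ^ (3 / 2 : ℝ)

/-- The `j`-th coefficient `lam j`, the `j`-th Fourier coefficient
`(2π)⁻¹ ∫_{-π}^{π} e^{-ijθ} (2 - 2 cos θ)^{3/2} dθ` of the symbol. The coefficient is a real number,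
see `ofReal_lam`, so that taking the real part only changes the type. -/
noncomputable def lam (j : ℤ) : ℝ :=
  (fourierCoeffOn (neg_lt_self Real.pi_pos) (fun θ : ℝ => (oddSymbol θ : ℂ)) j).re

theorem ofReal_lam (j : ℤ) :
    (lam j : ℂ) =
      fourierCoeffOn (neg_lt_self Real.pi_pos) (fun θ : ℝ => (oddSymbol θ : ℂ)) j := by
  rw [lam, ← Complex.conj_eq_iff_re, fourierCoeffOn_eq_integral]
  rw [Complex.real_smul, map_mul, Complex.conj_ofReal]
  congr 1
  rw [← intervalIntegral.intervalIntegral_conj]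
  have h := intervalIntegral.integral_comp_neg (a := -Real.pi) (b := Real.pi)
    (fun x : ℝ => (fourier (-j) (x : AddCircle (Real.pi - -Real.pi)) : ℂ) • (oddSymbol x : ℂ))
  rw [neg_neg] at h
  rw [← h]
  refine intervalIntegral.integral_congr fun x _ => ?_
  simp [oddSymbol]

/-- The quasi-Lagrange function `ψ(x) = ∑_{j ∈ ℤ} λ_j φ(|x - j|)`, divided by `2π` so that its
Fourier transform has value `1` at the origin. -/
noncomputable def quasiLagrange (x : ℝ) : ℝ :=
  (2 * Real.pi)⁻¹ * ∑' j : ℤ, lam j * thinPlateSpline |x - j|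

theorem oddSymbol_eq_abs_sin (θ : ℝ) : oddSymbol θ = 8 * |Real.sin (θ / 2)| ^ 3 := by
  have h : 2 - 2 * Real.cos θ = (2 * |Real.sin (θ / 2)|) ^ 2 := by
    have h1 := Real.cos_sq_add_sin_sq (θ / 2)
    have h2 := Real.cos_two_mul (θ / 2)
    rw [mul_div_cancel₀ θ two_ne_zero] at h2
    rw [mul_pow, sq_abs]
    linarith
  rw [oddSymbol, h, ← Real.rpow_natCast, ← Real.rpow_mul (by positivity)]
  norm_num
  rw [mul_pow]
  norm_num

theorem continuous_oddSymbol : Continuous oddSymbol := by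
  have : oddSymbol = fun θ => 8 * |Real.sin (θ / 2)| ^ 3 := funext oddSymbol_eq_abs_sin
  rw [this]
  fun_prop

theorem lam_eq_integral (j : ℤ) :
    lam j = (2 * Real.pi)⁻¹ * ∫ θ in -Real.pi..Real.pi, Real.cos (j * θ) * oddSymbol θ := by
  rw [lam, fourierCoeffOn_eq_integral, Complex.real_smul, Complex.re_ofReal_mul]
  have hc : Continuous fun x : ℝ =>
      (fourier (-j) (x : AddCircle (Real.pi - -Real.pi)) : ℂ) • (oddSymbol x : ℂ) := by
    have := continuous_oddSymbol
    have h2 : Continuous fun x : ℝ => (x : AddCircle (Real.pi - -Real.pi)) :=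
      AddCircle.continuous_mk' _
    fun_prop
  have := Complex.reCLM.intervalIntegral_comp_comm
    (hc.intervalIntegrable (μ := MeasureTheory.volume) (-Real.pi) Real.pi)
  simp only [Complex.reCLM_apply] at this
  rw [← this]
  congr 1
  · ring
  · refine intervalIntegral.integral_congr fun x _ => ?_
    simp only [smul_eq_mul, Complex.re_mul_ofReal]
    congr 1
    rw [fourier_coe_apply]
    have : 2 * (Real.pi : ℂ) * Complex.I * (-j : ℤ) * x / (Real.pi - -Real.pi : ℝ) =
        ((-(j * x) : ℝ) : ℂ) * Complex.I := by
      have : (Real.pi : ℂ) ≠ 0 := by exact_mod_cast Real.pi_ne_zero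
      push_cast
      field_simp
      ring
    rw [this, Complex.exp_ofReal_mul_I_re, Real.cos_neg]

theorem intCast_ne_add_half (j m : ℤ) : (j : ℝ) ≠ m + 1 / 2 := by
  intro h
  have : (2 * j : ℤ) = 2 * m + 1 := by
    have : (2 * j : ℝ) = 2 * m + 1 := by linarith
    exact_mod_cast this
  omega

theorem integral_cos_mul_sin_half (j m : ℤ) :
    ∫ θ in (0 : ℝ)..Real.pi, Real.cos (j * θ) * Real.sin ((m + 1 / 2) * θ) =
      (m + 1 / 2) / ((m + 1 / 2) ^ 2 - j ^ 2) := by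
  have c1 : Real.cos ((j + (m + 1 / 2)) * Real.pi) = 0 := by
    rw [Real.cos_eq_zero_iff]; exact ⟨j + m, by push_cast; ring⟩
  have c2 : Real.cos ((j - (m + 1 / 2)) * Real.pi) = 0 := by
    rw [Real.cos_eq_zero_iff]; exact ⟨j - m - 1, by push_cast; ring⟩
  have h1 : (j : ℝ) + (m + 1 / 2) ≠ 0 := by
    intro h; apply intCast_ne_add_half j (-m - 1); push_cast; linarith
  have h2 : (j : ℝ) - (m + 1 / 2) ≠ 0 := sub_ne_zero.2 (intCast_ne_add_half j m)
  generalize (m : ℝ) + 1 / 2 = a at *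
  generalize (j : ℝ) = b at *
  have hd : ∀ θ : ℝ, HasDerivAt
      (fun θ : ℝ => -Real.cos ((b + a) * θ) / (2 * (b + a)) +
        Real.cos ((b - a) * θ) / (2 * (b - a)))
      (Real.cos (b * θ) * Real.sin (a * θ)) θ := by
    intro θ
    have e1 := ((hasDerivAt_id θ).const_mul (b + a)).cos.neg.div_const (2 * (b + a))
    have e2 := ((hasDerivAt_id θ).const_mul (b - a)).cos.div_const (2 * (b - a))
    convert! e1.add e2 using 1
    have s1 : Real.sin ((b + a) * θ) =
        Real.sin (b * θ) * Real.cos (a * θ) + Real.cos (b * θ) * Real.sin (a * θ) := by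
      rw [add_mul, Real.sin_add]
    have s2 : Real.sin ((b - a) * θ) =
        Real.sin (b * θ) * Real.cos (a * θ) - Real.cos (b * θ) * Real.sin (a * θ) := by
      rw [sub_mul, Real.sin_sub]
    simp only [id, mul_one, s1, s2]
    generalize b + a = c at *
    generalize b - a = d at *
    field_simp
    ring
  rw [intervalIntegral.integral_eq_sub_of_hasDerivAt (fun θ _ => hd θ)
    (Continuous.intervalIntegrable (by fun_prop) _ _)]
  rw [c1, c2, mul_zero, mul_zero, Real.cos_zero, neg_zero, zero_div, zero_div, add_zero, zero_sub,
    show a ^ 2 - b ^ 2 = -((b + a) * (b - a)) by ring]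
  field_simp
  ring

theorem sq_sub_quarter_ne_zero (j : ℤ) : (j : ℝ) ^ 2 - 1 / 4 ≠ 0 := by
  have h1 := intCast_ne_add_half j 0
  have h2 := intCast_ne_add_half j (-1)
  push_cast at h1 h2
  have := mul_ne_zero (sub_ne_zero.2 h1) (sub_ne_zero.2 h2)
  intro h; apply this; linarith

theorem sq_sub_nine_quarters_ne_zero (j : ℤ) : (j : ℝ) ^ 2 - 9 / 4 ≠ 0 := by
  have h1 := intCast_ne_add_half j 1
  have h2 := intCast_ne_add_half j (-2)
  push_cast at h1 h2
  have := mul_ne_zero (sub_ne_zero.2 h1) (sub_ne_zero.2 h2)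
  intro h; apply this; linarith

theorem lam_eq (j : ℤ) :
    lam j = 6 / Real.pi / (((j : ℝ) ^ 2 - 1 / 4) * ((j : ℝ) ^ 2 - 9 / 4)) := by
  have hc : Continuous fun θ : ℝ => Real.cos (j * θ) * oddSymbol θ := by
    have := continuous_oddSymbol
    fun_prop
  have he : ∫ θ in -Real.pi..0, Real.cos (j * θ) * oddSymbol θ =
      ∫ θ in 0..Real.pi, Real.cos (j * θ) * oddSymbol θ := by
    have := intervalIntegral.integral_comp_neg (a := 0) (b := Real.pi)
      (fun θ : ℝ => Real.cos (j * θ) * oddSymbol θ)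
    rw [neg_zero] at this
    rw [← this]
    refine intervalIntegral.integral_congr fun x _ => ?_
    simp [oddSymbol]
  have hp : ∫ θ in 0..Real.pi, Real.cos (j * θ) * oddSymbol θ =
      6 * ((1 / 2) / ((1 / 2) ^ 2 - (j : ℝ) ^ 2)) - 2 * ((3 / 2) / ((3 / 2) ^ 2 - (j : ℝ) ^ 2)) := by
    have i0 := integral_cos_mul_sin_half j 0
    have i1 := integral_cos_mul_sin_half j 1
    push_cast at i0 i1
    rw [zero_add] at i0
    rw [show (1 : ℝ) + 1 / 2 = 3 / 2 by norm_num] at i1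
    rw [← i0, ← i1, ← intervalIntegral.integral_const_mul, ← intervalIntegral.integral_const_mul,
      ← intervalIntegral.integral_sub (Continuous.intervalIntegrable (by fun_prop) _ _)
        (Continuous.intervalIntegrable (by fun_prop) _ _)]
    refine intervalIntegral.integral_congr fun x hx => ?_
    rw [Set.uIcc_of_le Real.pi_pos.le] at hx
    have hs : 0 ≤ Real.sin (x / 2) :=
      Real.sin_nonneg_of_nonneg_of_le_pi (by linarith [hx.1]) (by linarith [hx.1, hx.2])
    have h3 := Real.sin_three_mul (x / 2)
    simp only [oddSymbol_eq_abs_sin, abs_of_nonneg hs]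
    rw [show 1 / 2 * x = x / 2 by ring, show 3 / 2 * x = 3 * (x / 2) by ring, h3]
    ring
  rw [lam_eq_integral, ← intervalIntegral.integral_add_adjacent_intervals
    (hc.intervalIntegrable (-Real.pi) 0) (hc.intervalIntegrable 0 Real.pi), he, hp]
  have h1 := sq_sub_quarter_ne_zero j
  have h2 := sq_sub_nine_quarters_ne_zero j
  rw [show (1 / 2) ^ 2 - (j : ℝ) ^ 2 = -((j : ℝ) ^ 2 - 1 / 4) by ring,
    show (3 / 2) ^ 2 - (j : ℝ) ^ 2 = -((j : ℝ) ^ 2 - 9 / 4) by ring]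
  have h3 : (j : ℝ) ^ 2 - 9 / 4 = (j : ℝ) ^ 2 - 1 / 4 - 2 := by ring
  rw [h3] at h2 ⊢
  generalize (j : ℝ) ^ 2 - 1 / 4 = A at *
  have hπ := Real.pi_ne_zero
  field_simp
  ring

theorem lam_neg (j : ℤ) : lam (-j) = lam j := by simp [lam_eq]

theorem abs_lam_le (j : ℤ) : |lam j| ≤ 32 / (1 + (j : ℝ) ^ 2) ^ 2 := by
  have h1 : (1 + (j : ℝ) ^ 2) / 4 ≤ |(j : ℝ) ^ 2 - 1 / 4| := by
    rcases eq_or_ne j 0 with rfl | h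
    · norm_num
    · have : (1 : ℝ) ≤ (j : ℝ) ^ 2 := by
        have : 1 ≤ j ^ 2 := by have := sq_pos_of_ne_zero h; omega
        exact_mod_cast this
      exact le_abs.2 (Or.inl (by linarith))
  have h2 : (1 + (j : ℝ) ^ 2) / 4 ≤ |(j : ℝ) ^ 2 - 9 / 4| := by
    rcases lt_or_ge (j ^ 2) 4 with h | h
    · have h' : j ^ 2 ≤ 1 := by
        have h3 : j < 2 := by nlinarith
        have h4 : -2 < j := by nlinarith
        interval_cases j <;> norm_num
      have : (j : ℝ) ^ 2 ≤ 1 := by exact_mod_cast h'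
      exact le_abs.2 (Or.inr (by linarith))
    · have : (4 : ℝ) ≤ (j : ℝ) ^ 2 := by exact_mod_cast h
      exact le_abs.2 (Or.inl (by linarith))
  rw [lam_eq, abs_div, abs_mul, abs_of_pos (div_pos (by norm_num : (0 : ℝ) < 6) Real.pi_pos)]
  have h3 : 6 / Real.pi ≤ 2 := by
    rw [div_le_iff₀ Real.pi_pos]; linarith [Real.pi_gt_three]
  calc _ ≤ 2 / ((1 + (j : ℝ) ^ 2) / 4 * ((1 + (j : ℝ) ^ 2) / 4)) := by gcongr
    _ = _ := by field_simp; norm_num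

theorem summable_abs_lam_mul_rpow (x : ℝ) {p : ℝ} (hp : 0 ≤ p) (hp' : p < 3) :
    Summable fun j : ℤ => |lam j| * |x - j| ^ p := by
  have hs : Summable fun j : ℤ => 32 * (2 * (1 + x ^ 2)) ^ (p / 2) * (1 / |(j : ℝ) + 0| ^ (4 - p)) :=
    ((Real.summable_one_div_int_add_rpow 0 (4 - p)).2 (by linarith)).mul_left _
  refine hs.of_norm_bounded_eventually ?_
  have hfin : ∀ᶠ j : ℤ in Filter.cofinite, j ≠ 0 := by
    rw [Filter.eventually_cofinite]; simp
  filter_upwards [hfin] with j hj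
  have hj' : (0 : ℝ) < |(j : ℝ)| := abs_pos.2 (by exact_mod_cast hj)
  rw [Real.norm_of_nonneg (by positivity), add_zero]
  have e1 : |x - j| ^ p ≤ (2 * (1 + x ^ 2)) ^ (p / 2) * (1 + (j : ℝ) ^ 2) ^ (p / 2) := by
    have : |x - j| ^ p = (|x - j| ^ (2 : ℝ)) ^ (p / 2) := by
      rw [← Real.rpow_mul (abs_nonneg _)]; congr 1; ring
    rw [this, ← Real.mul_rpow (by positivity) (by positivity)]
    apply Real.rpow_le_rpow (by positivity) _ (by linarith)
    rw [Real.rpow_two, sq_abs]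
    nlinarith [sq_nonneg (x + j), mul_nonneg (sq_nonneg x) (sq_nonneg (j : ℝ))]
  have e2 : (1 + (j : ℝ) ^ 2) ^ (p / 2) / (1 + (j : ℝ) ^ 2) ^ 2 ≤ 1 / |(j : ℝ)| ^ (4 - p) := by
    have h1 : (0 : ℝ) < 1 + (j : ℝ) ^ 2 := by positivity
    rw [← Real.rpow_natCast (1 + (j : ℝ) ^ 2), ← Real.rpow_sub h1]
    have : |(j : ℝ)| ^ (4 - p) = ((j : ℝ) ^ 2) ^ (-(p / 2 - (2 : ℕ))) := by
      rw [← sq_abs, ← Real.rpow_natCast, ← Real.rpow_mul (abs_nonneg _)]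
      congr 1; push_cast; ring
    rw [this, Real.rpow_neg (by positivity), one_div, inv_inv]
    apply Real.rpow_le_rpow_of_nonpos (by rw [← sq_abs]; positivity) (by linarith)
    push_cast; linarith
  calc |lam j| * |x - j| ^ p
      ≤ 32 / (1 + (j : ℝ) ^ 2) ^ 2 * ((2 * (1 + x ^ 2)) ^ (p / 2) * (1 + (j : ℝ) ^ 2) ^ (p / 2)) := by
        gcongr; exact abs_lam_le j
    _ = 32 * (2 * (1 + x ^ 2)) ^ (p / 2) *
          ((1 + (j : ℝ) ^ 2) ^ (p / 2) / (1 + (j : ℝ) ^ 2) ^ 2) := by ring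
    _ ≤ _ := by gcongr

theorem summable_abs_lam : Summable fun j : ℤ => |lam j| := by
  simpa using summable_abs_lam_mul_rpow 0 le_rfl (by norm_num)

theorem hasSum_lam_mul_exp (ξ : ℝ) :
    HasSum (fun j : ℤ => (lam j : ℂ) * Complex.exp (j * ξ * Complex.I)) (oddSymbol ξ) := by
  have hT : 0 < Real.pi - -Real.pi := by linarith [Real.pi_pos]
  have : Fact (0 < Real.pi - -Real.pi) := ⟨hT⟩
  have hper : Function.Periodic (fun θ : ℝ => (oddSymbol θ : ℂ)) (Real.pi - -Real.pi) := by
    intro θ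
    rw [show Real.pi - -Real.pi = 2 * Real.pi by ring]
    simp [oddSymbol]
  have hcont : Continuous hper.lift := by
    apply continuous_coinduced_dom.mpr
    have := continuous_oddSymbol
    change Continuous fun θ : ℝ => (oddSymbol θ : ℂ)
    fun_prop
  let f : C(AddCircle (Real.pi - -Real.pi), ℂ) := ⟨hper.lift, hcont⟩
  have hcoef : ∀ j, fourierCoeff f j = lam j := by
    intro j
    rw [ofReal_lam, fourierCoeffOn_eq_integral, fourierCoeff_eq_intervalIntegral _ _ (-Real.pi),
      show -Real.pi + (Real.pi - -Real.pi) = Real.pi by ring]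
    rfl
  have hsum : Summable (fourierCoeff f) := by
    simp_rw +singlePass [funext hcoef]
    apply Summable.of_norm
    simpa using summable_abs_lam
  have key := has_pointwise_sum_fourier_series_of_summable hsum (ξ : AddCircle (Real.pi - -Real.pi))
  convert! key using 2 with j
  rw [hcoef, smul_eq_mul, fourier_coe_apply]
  congr 2
  have : (Real.pi : ℂ) ≠ 0 := by exact_mod_cast Real.pi_ne_zero
  push_cast
  field_simp
  ring

theorem hasSum_lam_mul_cos (x ξ : ℝ) :
    HasSum (fun j : ℤ => lam j * Real.cos (ξ * (x - j))) (Real.cos (ξ * x) * oddSymbol ξ) := by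
  have h := Complex.hasSum_re ((hasSum_lam_mul_exp ξ).mul_left (Complex.exp ((-(ξ * x) : ℝ) * Complex.I)))
  convert! h using 1
  · funext j
    rw [mul_left_comm, ← Complex.exp_add, Complex.re_ofReal_mul,
      show ((-(ξ * x) : ℝ) : ℂ) * Complex.I + j * ξ * Complex.I =
        ((-(ξ * (x - j)) : ℝ) : ℂ) * Complex.I by push_cast; ring,
      Complex.exp_ofReal_mul_I_re, Real.cos_neg]
  · rw [Complex.re_mul_ofReal, Complex.exp_ofReal_mul_I_re, Real.cos_neg]

theorem tsum_int_sub_succ_eq_zero {F : ℤ → ℝ} (hs : Summable fun j : ℤ => F j - F (j + 1))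
    (h1 : Filter.Tendsto (fun n : ℕ => F n) Filter.atTop (nhds 0))
    (h2 : Filter.Tendsto (fun n : ℕ => F (-n)) Filter.atTop (nhds 0)) :
    ∑' j : ℤ, (F j - F (j + 1)) = 0 := by
  have s1 : Summable fun n : ℕ => F (n : ℤ) - F (n + 1) :=
    (hs.comp_injective (Nat.cast_injective (R := ℤ))).congr fun n => rfl
  have s2 : Summable fun n : ℕ => F (-(n + 1 : ℤ)) - F (-(n + 1 : ℤ) + 1) :=
    (hs.comp_injective (i := Int.negSucc) fun a b h => Int.negSucc.inj h).congr fun n => by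
      simp only [Function.comp_apply, Int.negSucc_eq]
  have t1 : ∑' n : ℕ, (F (n : ℤ) - F (n + 1)) = F 0 := by
    refine tendsto_nhds_unique s1.hasSum.tendsto_sum_nat ?_
    have h n : ∑ i ∈ Finset.range n, (F (i : ℤ) - F (i + 1)) = F 0 - F n := by
      simpa using Finset.sum_range_sub' (fun n : ℕ => F n) n
    simp_rw [h]
    simpa using (tendsto_const_nhds (x := F 0)).sub h1
  have t2 : ∑' n : ℕ, (F (-(n + 1 : ℤ)) - F (-(n + 1 : ℤ) + 1)) = -F 0 := by
    refine tendsto_nhds_unique s2.hasSum.tendsto_sum_nat ?_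
    have h n : ∑ i ∈ Finset.range n, (F (-(i + 1 : ℤ)) - F (-(i + 1 : ℤ) + 1)) = F (-n) - F 0 := by
      have := Finset.sum_range_sub (fun n : ℕ => F (-n)) n
      simp only [Nat.cast_add, Nat.cast_one, Nat.cast_zero, neg_zero] at this
      rw [← this]
      refine Finset.sum_congr rfl fun i _ => ?_
      rw [neg_add_rev, neg_add_cancel_comm]
    simp_rw [h]
    simpa using h2.sub (tendsto_const_nhds (x := F 0))
  have := (HasSum.of_nat_of_neg_add_one (f := fun j : ℤ => F j - F (j + 1))
    s1.hasSum s2.hasSum).tsum_eq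
  rw [this, t1, t2, add_neg_cancel]

theorem tendsto_inv_natCast_add (c : ℝ) :
    Filter.Tendsto (fun n : ℕ => ((n : ℝ) + c)⁻¹) Filter.atTop (nhds 0) :=
  tendsto_inv_atTop_zero.comp
    (Filter.tendsto_atTop_add_const_right _ _ tendsto_natCast_atTop_atTop)

theorem summable_lam_mul_sq (x : ℝ) : Summable fun j : ℤ => lam j * (x - j) ^ 2 := by
  apply Summable.of_norm
  simpa [abs_mul] using summable_abs_lam_mul_rpow x (p := 2) (by norm_num) (by norm_num)

theorem tsum_lam_mul_intCast_sq : ∑' j : ℤ, lam j * (j : ℝ) ^ 2 = 0 := by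
  let F : ℤ → ℝ := fun j => 6 / Real.pi * (-(1 / 8) * (j + (-1 / 2) : ℝ)⁻¹ + 3 / 8 *
    ((j + (-3 / 2) : ℝ)⁻¹ + (j + (-1 / 2) : ℝ)⁻¹ + (j + (1 / 2) : ℝ)⁻¹))
  have hF : ∀ j : ℤ, lam j * (j : ℝ) ^ 2 = F j - F (j + 1) := by
    intro j
    have h1 : (j : ℝ) + (-1 / 2) ≠ 0 := by
      have := intCast_ne_add_half j 0; push_cast at this; intro h; apply this; linarith
    have h2 : (j : ℝ) + (1 / 2) ≠ 0 := by
      have := intCast_ne_add_half j (-1); push_cast at this; intro h; apply this; linarith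
    have h3 : (j : ℝ) + (-3 / 2) ≠ 0 := by
      have := intCast_ne_add_half j 1; push_cast at this; intro h; apply this; linarith
    have h4 : (j : ℝ) + (3 / 2) ≠ 0 := by
      have := intCast_ne_add_half j (-2); push_cast at this; intro h; apply this; linarith
    have hπ := Real.pi_ne_zero
    simp only [F]
    push_cast
    rw [lam_eq, show (j : ℝ) ^ 2 - 1 / 4 = (j + (-1 / 2)) * (j + (1 / 2)) by ring,
      show (j : ℝ) ^ 2 - 9 / 4 = (j + (-3 / 2)) * (j + (3 / 2)) by ring,
      show (j : ℝ) + 1 + (-1 / 2) = j + 1 / 2 by ring,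
      show (j : ℝ) + 1 + (-3 / 2) = j + (-1 / 2) by ring,
      show (j : ℝ) + 1 + (1 / 2) = j + (3 / 2) by ring]
    obtain ⟨y, hy⟩ : ∃ y : ℝ, (j : ℝ) = y + 3 / 2 := ⟨j - 3 / 2, by ring⟩
    rw [hy] at h1 h2 h3 h4 ⊢
    simp only [show y + 3 / 2 + -1 / 2 = y + 1 by ring, show y + 3 / 2 + 1 / 2 = y + 2 by ring,
      show y + 3 / 2 + -3 / 2 = y by ring, show y + 3 / 2 + 3 / 2 = y + 3 by ring] at h1 h2 h3 h4 ⊢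
    field_simp
    ring
  have hs : Summable fun j : ℤ => F j - F (j + 1) := by
    simpa [hF] using summable_lam_mul_sq 0
  simp_rw [hF]
  refine tsum_int_sub_succ_eq_zero hs ?_ ?_
  · have := (((tendsto_inv_natCast_add (-1 / 2)).const_mul (-(1 / 8))).add
      ((((tendsto_inv_natCast_add (-3 / 2)).add (tendsto_inv_natCast_add (-1 / 2))).add
        (tendsto_inv_natCast_add (1 / 2))).const_mul (3 / 8))).const_mul (6 / Real.pi)
    simpa [F] using this
  · have := (((tendsto_inv_natCast_add (1 / 2)).const_mul (1 / 8)).add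
      ((((tendsto_inv_natCast_add (3 / 2)).add (tendsto_inv_natCast_add (1 / 2))).add
        (tendsto_inv_natCast_add (-1 / 2))).const_mul (-(3 / 8)))).const_mul (6 / Real.pi)
    simp only [add_zero, mul_zero] at this
    refine this.congr fun n => ?_
    simp only [F]
    push_cast
    rw [show -(n : ℝ) + -1 / 2 = -(n + 1 / 2) by ring, show -(n : ℝ) + -3 / 2 = -(n + 3 / 2) by ring,
      show -(n : ℝ) + 1 / 2 = -(n + -1 / 2) by ring, inv_neg, inv_neg, inv_neg]
    ring

theorem hasSum_lam : HasSum lam 0 := by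
  simpa [oddSymbol] using hasSum_lam_mul_cos 0 0

theorem tsum_lam_mul_intCast : ∑' j : ℤ, lam j * (j : ℝ) = 0 := by
  have h := (Equiv.neg ℤ).tsum_eq fun j : ℤ => lam j * (j : ℝ)
  simp only [Equiv.neg_apply, lam_neg, Int.cast_neg, mul_neg, tsum_neg] at h
  linarith

theorem hasSum_lam_mul_sq (x : ℝ) : HasSum (fun j : ℤ => lam j * (x - j) ^ 2) 0 := by
  have h1 : Summable fun j : ℤ => lam j * (j : ℝ) := by
    apply Summable.of_norm
    simpa [abs_mul] using summable_abs_lam_mul_rpow 0 (p := 1) (by norm_num) (by norm_num)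
  have h2 : Summable fun j : ℤ => lam j * (j : ℝ) ^ 2 := by simpa using summable_lam_mul_sq 0
  have a := hasSum_lam.mul_right (x ^ 2)
  have b := h1.hasSum.mul_right (-2 * x)
  have c := h2.hasSum
  rw [tsum_lam_mul_intCast] at b
  rw [tsum_lam_mul_intCast_sq] at c
  convert! (a.add b).add c using 1
  · funext j; ring
  · ring

/-- The absolutely integrable kernel whose integral over `ξ > 0` is half of `y ^ 2 * log |y|`. -/
noncomputable def tpsKernel (y ξ : ℝ) : ℝ :=
  (Real.cos (ξ * y) - 1 - y ^ 2 * (Real.cos ξ - 1)) / ξ ^ 3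

theorem abs_cos_sub_one_add_sq_le (t : ℝ) :
    |Real.cos t - 1 + t ^ 2 / 2| ≤ |t| ^ (5 / 2 : ℝ) := by
  rcases le_total |t| 1 with h | h
  · have h1 := Real.cos_bound h
    rw [show Real.cos t - 1 + t ^ 2 / 2 = Real.cos t - (1 - t ^ 2 / 2) by ring]
    have h2 : |t| ^ 4 ≤ |t| ^ (5 / 2 : ℝ) := by
      rw [← Real.rpow_natCast]
      exact Real.rpow_le_rpow_of_exponent_ge_of_imp (abs_nonneg _) h (by norm_num)
        (fun _ h => absurd h (by norm_num))
    have h3 : 0 ≤ |t| ^ 4 := by positivity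
    linarith
  · have h2 : |t| ^ (2 : ℕ) ≤ |t| ^ (5 / 2 : ℝ) := by
      rw [← Real.rpow_natCast]
      exact Real.rpow_le_rpow_of_exponent_le h (by norm_num)
    rw [sq_abs] at h2
    have h3 := Real.one_sub_sq_div_two_le_cos (x := t)
    have h4 := Real.cos_le_one t
    rw [abs_le]
    constructor <;> nlinarith [sq_nonneg t]

theorem abs_tpsKernel_le_of_le_one (y : ℝ) {ξ : ℝ} (h0 : 0 < ξ) :
    |tpsKernel y ξ| ≤ (|y| ^ (5 / 2 : ℝ) + y ^ 2) * ξ ^ (-(1 / 2) : ℝ) := by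
  have e1 := abs_cos_sub_one_add_sq_le (ξ * y)
  have e2 := abs_cos_sub_one_add_sq_le ξ
  rw [abs_mul, Real.mul_rpow (abs_nonneg _) (abs_nonneg _), abs_of_pos h0] at e1
  rw [abs_of_pos h0] at e2
  have h3 : ξ ^ (-(1 / 2) : ℝ) = ξ ^ (5 / 2 : ℝ) / ξ ^ 3 := by
    rw [← Real.rpow_natCast, ← Real.rpow_sub h0]; norm_num
  rw [tpsKernel, abs_div, abs_of_pos (pow_pos h0 3), h3, mul_div_assoc']
  gcongr
  calc |Real.cos (ξ * y) - 1 - y ^ 2 * (Real.cos ξ - 1)|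
      = |(Real.cos (ξ * y) - 1 + (ξ * y) ^ 2 / 2) - y ^ 2 * (Real.cos ξ - 1 + ξ ^ 2 / 2)| := by
        ring_nf
    _ ≤ |Real.cos (ξ * y) - 1 + (ξ * y) ^ 2 / 2| + |y ^ 2 * (Real.cos ξ - 1 + ξ ^ 2 / 2)| :=
        abs_sub _ _
    _ ≤ ξ ^ (5 / 2 : ℝ) * |y| ^ (5 / 2 : ℝ) + y ^ 2 * ξ ^ (5 / 2 : ℝ) := by
        rw [abs_mul (y ^ 2), abs_of_nonneg (sq_nonneg y)]
        gcongr
    _ = _ := by ring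

theorem abs_tpsKernel_le (y : ℝ) {ξ : ℝ} (h0 : 0 < ξ) :
    |tpsKernel y ξ| ≤ (2 + 2 * y ^ 2) * ξ ^ (-3 : ℝ) := by
  rw [tpsKernel, abs_div, abs_of_pos (pow_pos h0 3), Real.rpow_neg h0.le, ← div_eq_mul_inv]
  norm_cast
  gcongr
  have a1 := Real.cos_le_one (ξ * y)
  have a2 := Real.neg_one_le_cos (ξ * y)
  have a3 := Real.cos_le_one ξ
  have a4 := Real.neg_one_le_cos ξ
  rw [abs_le]
  constructor <;> nlinarith [sq_nonneg y]

theorem measurable_tpsKernel (y : ℝ) : Measurable (tpsKernel y) := by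
  unfold tpsKernel; fun_prop

open MeasureTheory Set Filter Topology in
theorem exists_integral_abs_tpsKernel_le : ∃ C : ℝ, 0 ≤ C ∧ ∀ y : ℝ,
    IntegrableOn (tpsKernel y) (Ioi 0) ∧
    ∫ ξ in Ioi 0, |tpsKernel y ξ| ≤ C * (|y| ^ (5 / 2 : ℝ) + |y| ^ (2 : ℝ) + 1) := by
  have i1 : IntegrableOn (fun ξ : ℝ => ξ ^ (-(1 / 2) : ℝ)) (Ioc 0 1) :=
    (intervalIntegrable_iff_integrableOn_Ioc_of_le zero_le_one).1
      (intervalIntegral.intervalIntegrable_rpow' (by norm_num))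
  have i2 : IntegrableOn (fun ξ : ℝ => ξ ^ (-3 : ℝ)) (Ioi 1) :=
    integrableOn_Ioi_rpow_of_lt (by norm_num) one_pos
  set A := ∫ ξ in Ioc (0 : ℝ) 1, ξ ^ (-(1 / 2) : ℝ) with hA
  set B := ∫ ξ in Ioi (1 : ℝ), ξ ^ (-3 : ℝ) with hB
  have A0 : 0 ≤ A := setIntegral_nonneg measurableSet_Ioc fun x hx => Real.rpow_nonneg hx.1.le _
  have B0 : 0 ≤ B :=
    setIntegral_nonneg measurableSet_Ioi fun x hx => Real.rpow_nonneg (zero_le_one.trans hx.le) _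
  refine ⟨A + 2 * B, by positivity, fun y => ?_⟩
  have b1 : ∀ ξ ∈ Ioc (0 : ℝ) 1, ‖tpsKernel y ξ‖ ≤
      (|y| ^ (5 / 2 : ℝ) + y ^ 2) * ξ ^ (-(1 / 2) : ℝ) :=
    fun ξ h => abs_tpsKernel_le_of_le_one y h.1
  have b2 : ∀ ξ ∈ Ioi (1 : ℝ), ‖tpsKernel y ξ‖ ≤ (2 + 2 * y ^ 2) * ξ ^ (-3 : ℝ) :=
    fun ξ h => abs_tpsKernel_le y (zero_lt_one.trans h)
  have j1 : IntegrableOn (tpsKernel y) (Ioc 0 1) :=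
    (i1.const_mul _).mono' (measurable_tpsKernel y).aestronglyMeasurable
      (ae_restrict_of_forall_mem measurableSet_Ioc b1)
  have j2 : IntegrableOn (tpsKernel y) (Ioi 1) :=
    (i2.const_mul _).mono' (measurable_tpsKernel y).aestronglyMeasurable
      (ae_restrict_of_forall_mem measurableSet_Ioi b2)
  have hU : Ioc (0 : ℝ) 1 ∪ Ioi 1 = Ioi 0 := Ioc_union_Ioi_eq_Ioi zero_le_one
  refine ⟨hU ▸ j1.union j2, ?_⟩
  have hsplit := setIntegral_union (Ioc_disjoint_Ioi le_rfl) measurableSet_Ioi j1.norm j2.norm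
  simp only [Real.norm_eq_abs] at hsplit
  rw [← hU, hsplit]
  have k1 : ∫ ξ in Ioc 0 1, |tpsKernel y ξ| ≤ (|y| ^ (5 / 2 : ℝ) + y ^ 2) * A := by
    rw [hA, ← integral_const_mul]
    exact setIntegral_mono_on j1.norm (i1.const_mul _) measurableSet_Ioc b1
  have k2 : ∫ ξ in Ioi 1, |tpsKernel y ξ| ≤ (2 + 2 * y ^ 2) * B := by
    rw [hB, ← integral_const_mul]
    exact setIntegral_mono_on j2.norm (i2.const_mul _) measurableSet_Ioi b2
  rw [Real.rpow_two, sq_abs]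
  have : 0 ≤ |y| ^ (5 / 2 : ℝ) := by positivity
  nlinarith [mul_nonneg this B0]

open MeasureTheory Set Filter Topology in
theorem integrableOn_tpsKernel (y : ℝ) : IntegrableOn (tpsKernel y) (Ioi 0) :=
  (exists_integral_abs_tpsKernel_le.choose_spec.2 y).1

open MeasureTheory Set Filter Topology in
theorem thinPlateSpline_abs_eq_integral (y : ℝ) :
    thinPlateSpline |y| = 2 * ∫ ξ in Ioi 0, tpsKernel y ξ := by
  rcases eq_or_ne y 0 with rfl | hy
  · simp [thinPlateSpline, tpsKernel]
  have hy' := abs_pos.2 hy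
  let f : ℝ → ℝ := fun t => (Real.cos t - 1) / t ^ 2
  have hker : ∀ ξ ∈ Ioi (0 : ℝ), tpsKernel y ξ = y ^ 2 * (ξ⁻¹ • (f (|y| * ξ) - f (1 * ξ))) := by
    intro ξ hξ
    have hξ' : ξ ≠ 0 := (mem_Ioi.1 hξ).ne'
    have h1 : Real.cos (ξ * y) = Real.cos (|y| * ξ) := by
      rw [← Real.cos_abs, abs_mul, abs_of_pos (mem_Ioi.1 hξ), mul_comm]
    simp only [f, tpsKernel, h1, smul_eq_mul, one_mul, mul_pow, sq_abs]
    field_simp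
  have hf : LocallyIntegrableOn f (Ioi 0) := by
    apply ContinuousOn.locallyIntegrableOn _ measurableSet_Ioi
    apply ContinuousOn.div (by fun_prop) (by fun_prop)
    intro x hx
    exact pow_ne_zero 2 (mem_Ioi.1 hx).ne'
  have hL : Tendsto f (𝓝[>] 0) (𝓝 (-(1 / 2))) := by
    have h1 : Tendsto (fun t : ℝ => |t| ^ (1 / 2 : ℝ)) (𝓝[>] 0) (𝓝 0) := by
      have : Continuous fun t : ℝ => |t| ^ (1 / 2 : ℝ) :=
        continuous_abs.rpow_const fun _ => Or.inr (by norm_num)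
      have := this.tendsto 0
      rw [abs_zero, Real.zero_rpow (by norm_num)] at this
      exact this.mono_left nhdsWithin_le_nhds
    refine tendsto_iff_norm_sub_tendsto_zero.2 (squeeze_zero' (Eventually.of_forall fun _ =>
      norm_nonneg _) ?_ h1)
    filter_upwards [self_mem_nhdsWithin] with t ht
    have ht' : 0 < t := ht
    have h2 := abs_cos_sub_one_add_sq_le t
    rw [show f t - -(1 / 2) = (Real.cos t - 1 + t ^ 2 / 2) / t ^ 2 by
      simp only [f]; field_simp; ring, Real.norm_eq_abs, abs_div, abs_of_pos (pow_pos ht' 2),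
      div_le_iff₀ (pow_pos ht' 2)]
    refine h2.trans_eq ?_
    rw [abs_of_pos ht', ← Real.rpow_natCast, ← Real.rpow_add ht']
    norm_num
  have hR : Tendsto f atTop (𝓝 0) := by
    have h1 : Tendsto (fun t : ℝ => 2 / t ^ 2) atTop (𝓝 0) :=
      tendsto_const_nhds.div_atTop (tendsto_pow_atTop two_ne_zero)
    refine squeeze_zero_norm (fun t => ?_) h1
    simp only [f, norm_div, Real.norm_eq_abs, abs_of_nonneg (sq_nonneg t)]
    gcongr
    rw [abs_le]
    constructor <;> linarith [Real.cos_le_one t, Real.neg_one_le_cos t]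
  have hint : IntegrableOn (fun ξ => ξ⁻¹ • (f (|y| * ξ) - f (1 * ξ))) (Ioi 0) := by
    refine ((integrableOn_tpsKernel y).const_mul (y ^ 2)⁻¹).congr ?_
    filter_upwards [ae_restrict_mem measurableSet_Ioi] with ξ hξ
    rw [hker ξ hξ]
    field_simp
  have key := Frullani.integral_Ioi_eq hf hy' one_pos hL hR hint
  rw [setIntegral_congr_fun measurableSet_Ioi hker, integral_const_mul, key, one_div,
    Real.log_inv, thinPlateSpline, sq_abs, smul_eq_mul]
  ring

open MeasureTheory Set Filter Topology in
theorem hasSum_lam_mul_thinPlateSpline (x : ℝ) :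
    HasSum (fun j : ℤ => lam j * thinPlateSpline |x - j|)
      (2 * ∫ ξ in Ioi 0, Real.cos (ξ * x) * oddSymbol ξ / ξ ^ 3) := by
  obtain ⟨C, hC, hK⟩ := exists_integral_abs_tpsKernel_le
  have h := hasSum_integral_of_summable_integral_norm (μ := volume.restrict (Ioi 0))
    (F := fun (j : ℤ) ξ => lam j * tpsKernel (x - j) ξ)
    (fun j => (hK (x - j)).1.const_mul _) (by
      have s1 := summable_abs_lam_mul_rpow x (p := 5 / 2) (by norm_num) (by norm_num)
      have s2 := summable_abs_lam_mul_rpow x (p := 2) (by norm_num) (by norm_num)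
      refine (((s1.add s2).add summable_abs_lam).mul_left C).of_nonneg_of_le
        (fun j => integral_nonneg fun _ => norm_nonneg _) fun j => ?_
      simp only [norm_mul, Real.norm_eq_abs, integral_const_mul]
      refine (mul_le_mul_of_nonneg_left (hK (x - j)).2 (abs_nonneg _)).trans_eq ?_
      ring)
  have h2 : ∫ ξ in Ioi 0, ∑' j : ℤ, lam j * tpsKernel (x - j) ξ =
      ∫ ξ in Ioi 0, Real.cos (ξ * x) * oddSymbol ξ / ξ ^ 3 := by
    congr 1
    funext ξ
    have e := (((hasSum_lam_mul_cos x ξ).sub hasSum_lam).sub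
      ((hasSum_lam_mul_sq x).mul_right (Real.cos ξ - 1))).div_const (ξ ^ 3)
    rw [zero_mul, sub_zero, sub_zero] at e
    rw [← e.tsum_eq]
    refine tsum_congr fun j => ?_
    rw [tpsKernel]
    ring
  rw [h2] at h
  convert! h.mul_left 2 using 1
  funext j
  rw [thinPlateSpline_abs_eq_integral, integral_const_mul]
  ring

open MeasureTheory Set in
theorem quasiLagrange_eq_integral (x : ℝ) :
    quasiLagrange x = Real.pi⁻¹ * ∫ ξ in Ioi 0, Real.cos (ξ * x) * oddSymbol ξ / ξ ^ 3 := by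
  rw [quasiLagrange, (hasSum_lam_mul_thinPlateSpline x).tsum_eq, mul_inv]
  ring

/-- The `k`-th derivative of the normalised cardinal sine `w ↦ sin (π w) / (π w)`, written as
`∫₀¹ (π t)^k cos (π w t + k π / 2) dt`. -/
noncomputable def normSincDeriv (k : ℕ) (w : ℝ) : ℝ :=
  ∫ t in (0 : ℝ)..1, (Real.pi * t) ^ k * Real.cos (Real.pi * w * t + k * (Real.pi / 2))

theorem abs_normSincDeriv_le (k : ℕ) (w : ℝ) : |normSincDeriv k w| ≤ Real.pi ^ k := by
  have h := intervalIntegral.norm_integral_le_of_norm_le_const (a := (0 : ℝ)) (b := 1)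
    (C := Real.pi ^ k)
    (f := fun t => (Real.pi * t) ^ k * Real.cos (Real.pi * w * t + k * (Real.pi / 2))) (by
      intro t ht
      rw [Set.uIoc_of_le zero_le_one] at ht
      rw [norm_mul, Real.norm_eq_abs, Real.norm_eq_abs,
        abs_of_nonneg (pow_nonneg (mul_nonneg Real.pi_pos.le ht.1.le) k), ← mul_one (Real.pi ^ k)]
      have h1 : Real.pi * t ≤ Real.pi := mul_le_of_le_one_right Real.pi_pos.le ht.2
      have h2 : 0 ≤ Real.pi * t := mul_nonneg Real.pi_pos.le ht.1.le
      gcongr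
      exact Real.abs_cos_le_one _)
  simpa [normSincDeriv] using h

theorem hasDerivAt_normSincDeriv (k : ℕ) (w : ℝ) :
    HasDerivAt (normSincDeriv k) (normSincDeriv (k + 1) w) w := by
  refine (intervalIntegral.hasDerivAt_integral_of_dominated_loc_of_deriv_le
    (F := fun w t => (Real.pi * t) ^ k * Real.cos (Real.pi * w * t + k * (Real.pi / 2)))
    (F' := fun w t => (Real.pi * t) ^ (k + 1) *
      Real.cos (Real.pi * w * t + (k + 1 : ℕ) * (Real.pi / 2)))
    (bound := fun t => |Real.pi * t| ^ (k + 1)) Filter.univ_mem ?_ ?_ ?_ ?_ ?_ ?_).2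
  · exact Filter.Eventually.of_forall fun w =>
      (Continuous.aestronglyMeasurable (by fun_prop))
  · exact Continuous.intervalIntegrable (by fun_prop) _ _
  · exact Continuous.aestronglyMeasurable (by fun_prop)
  · refine Filter.Eventually.of_forall fun t _ w _ => ?_
    rw [norm_mul, norm_pow, Real.norm_eq_abs, Real.norm_eq_abs]
    exact mul_le_of_le_one_right (by positivity) (Real.abs_cos_le_one _)
  · exact Continuous.intervalIntegrable (by fun_prop) _ _
  · refine Filter.Eventually.of_forall fun t _ w _ => ?_
    have := (((((hasDerivAt_id w).const_mul Real.pi).mul_const t).add_const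
      (k * (Real.pi / 2))).cos).const_mul ((Real.pi * t) ^ k)
    refine this.congr_deriv ?_
    rw [show Real.pi * w * t + ((k + 1 : ℕ) : ℝ) * (Real.pi / 2) =
      Real.pi * w * t + k * (Real.pi / 2) + Real.pi / 2 by push_cast; ring,
      Real.cos_add_pi_div_two]
    simp only [id]
    ring

theorem continuous_normSincDeriv (k : ℕ) : Continuous (normSincDeriv k) :=
  continuous_iff_continuousAt.2 fun w => (hasDerivAt_normSincDeriv k w).continuousAt

theorem mul_normSincDeriv_zero (w : ℝ) :
    w * normSincDeriv 0 w = Real.sin (Real.pi * w) / Real.pi := by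
  have hd : ∀ t : ℝ, HasDerivAt (fun t => Real.sin (Real.pi * w * t) / Real.pi)
      (w * Real.cos (Real.pi * w * t)) t := by
    intro t
    refine (((hasDerivAt_id t).const_mul (Real.pi * w)).sin.div_const Real.pi).congr_deriv ?_
    have := Real.pi_ne_zero
    simp only [id]
    field_simp
  have := intervalIntegral.integral_eq_sub_of_hasDerivAt (a := 0) (b := 1) (fun t _ => hd t)
    (Continuous.intervalIntegrable (by fun_prop) _ _)
  rw [intervalIntegral.integral_const_mul] at this
  simpa [normSincDeriv] using this

theorem normSincDeriv_zero_zero : normSincDeriv 0 0 = 1 := by simp [normSincDeriv]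

theorem normSincDeriv_one_zero : normSincDeriv 1 0 = 0 := by simp [normSincDeriv]

theorem normSincDeriv_zero_neg (w : ℝ) : normSincDeriv 0 (-w) = normSincDeriv 0 w := by
  simp [normSincDeriv]

theorem normSincDeriv_zero_intCast {n : ℤ} (hn : n ≠ 0) : normSincDeriv 0 n = 0 := by
  have h := mul_normSincDeriv_zero n
  rw [mul_comm Real.pi, Real.sin_int_mul_pi, zero_div] at h
  exact (mul_eq_zero.1 h).resolve_left (by exact_mod_cast hn)

theorem normSincDeriv_zero_add_mul (w : ℝ) :
    normSincDeriv 0 w + w * normSincDeriv 1 w = Real.cos (Real.pi * w) := by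
  have h1 := (hasDerivAt_id w).mul (hasDerivAt_normSincDeriv 0 w)
  have h2 : HasDerivAt (fun w => w * normSincDeriv 0 w) (Real.cos (Real.pi * w)) w := by
    rw [funext mul_normSincDeriv_zero]
    refine (((hasDerivAt_id w).const_mul Real.pi).sin.div_const Real.pi).congr_deriv ?_
    have := Real.pi_ne_zero
    simp only [id]
    field_simp
  simpa using h1.unique h2

theorem two_mul_normSincDeriv_one_add_mul (w : ℝ) :
    2 * normSincDeriv 1 w + w * normSincDeriv 2 w = -(Real.pi * Real.sin (Real.pi * w)) := by
  have h1 := (hasDerivAt_normSincDeriv 0 w).add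
    ((hasDerivAt_id w).mul (hasDerivAt_normSincDeriv 1 w))
  have h2 : HasDerivAt (fun w => normSincDeriv 0 w + w * normSincDeriv 1 w)
      (-(Real.pi * Real.sin (Real.pi * w))) w := by
    rw [funext normSincDeriv_zero_add_mul]
    refine (((hasDerivAt_id w).const_mul Real.pi).cos).congr_deriv ?_
    simp only [id]
    ring
  have := h1.unique h2
  simp only [id] at this
  rw [← this]
  ring

theorem three_mul_normSincDeriv_two_add_mul (w : ℝ) :
    3 * normSincDeriv 2 w + w * normSincDeriv 3 w =
      -(Real.pi ^ 2 * Real.cos (Real.pi * w)) := by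
  have h1 := ((hasDerivAt_normSincDeriv 1 w).const_mul 2).add
    ((hasDerivAt_id w).mul (hasDerivAt_normSincDeriv 2 w))
  have h2 : HasDerivAt (fun w => 2 * normSincDeriv 1 w + w * normSincDeriv 2 w)
      (-(Real.pi ^ 2 * Real.cos (Real.pi * w))) w := by
    rw [funext two_mul_normSincDeriv_one_add_mul]
    refine (((hasDerivAt_id w).const_mul Real.pi).sin.const_mul Real.pi).neg.congr_deriv ?_
    simp only [id]
    ring
  have := h1.unique h2
  simp only [id] at this
  rw [← this]
  ring

theorem exists_abs_normSincDeriv_le : ∃ M : ℝ, 1 ≤ M ∧ ∀ k ≤ 3, ∀ w : ℝ,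
    |normSincDeriv k w| ≤ M * (1 + |w|)⁻¹ := by
  have hπ := Real.pi_gt_three
  have hπ' := Real.pi_le_four
  refine ⟨1000, by norm_num, fun k hk w => ?_⟩
  rw [← div_eq_mul_inv, le_div_iff₀ (by positivity), mul_add, mul_one]
  have b := fun k => abs_normSincDeriv_le k w
  have p : ∀ k ≤ 3, Real.pi ^ k ≤ 64 := fun k hk => by
    calc Real.pi ^ k ≤ 4 ^ k := by gcongr
      _ ≤ 4 ^ 3 := by gcongr; norm_num
      _ = 64 := by norm_num
  have b' : ∀ k ≤ 3, |normSincDeriv k w| ≤ 64 := fun k hk => (b k).trans (p k hk)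
  have m : ∀ k ≤ 3, |normSincDeriv k w| * |w| ≤ 400 := by
    intro k hk
    rw [mul_comm, ← abs_mul]
    have c1 := abs_le.1 (Real.abs_cos_le_one (Real.pi * w))
    have c2 := abs_le.1 (Real.abs_sin_le_one (Real.pi * w))
    have d0 := abs_le.1 (b' 0 (by norm_num))
    have d1 := abs_le.1 (b' 1 (by norm_num))
    have d2 := abs_le.1 (b' 2 (by norm_num))
    have e0 := mul_normSincDeriv_zero w
    have e1 := normSincDeriv_zero_add_mul w
    have e2 := two_mul_normSincDeriv_one_add_mul w
    have e3 := three_mul_normSincDeriv_two_add_mul w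
    interval_cases k
    · rw [e0, abs_div, abs_of_pos Real.pi_pos, div_le_iff₀ Real.pi_pos]
      have := Real.abs_sin_le_one (Real.pi * w)
      linarith
    · rw [abs_le]; constructor <;> linarith
    · rw [abs_le]; constructor <;> nlinarith
    · have := p 2 (by norm_num)
      have : 0 ≤ Real.pi ^ 2 := by positivity
      rw [abs_le]; constructor <;> nlinarith
  have := b' k hk
  have := m k hk
  linarith

theorem hasDerivAt_mul_abs (u : ℝ) : HasDerivAt (fun u : ℝ => u * |u|) (2 * |u|) u := by
  rcases eq_or_ne u 0 with rfl | h
  · rw [hasDerivAt_iff_tendsto_slope_zero]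
    have h1 : Filter.Tendsto (fun t : ℝ => |t|) (nhdsWithin 0 {0}ᶜ) (nhds (2 * |0|)) := by
      simpa using (continuous_abs.tendsto (0 : ℝ)).mono_left nhdsWithin_le_nhds
    refine h1.congr' ?_
    filter_upwards [self_mem_nhdsWithin] with t ht
    have ht' : t ≠ 0 := ht
    simp [ht']
  · refine ((hasDerivAt_id u).mul (hasDerivAt_abs h)).congr_deriv ?_
    simp only [id, one_mul]
    rw [self_mul_sign]
    ring

/-- The Fourier transform `|sin (π w) / (π w)| ^ 3` of the quasi-Lagrange function. -/
noncomputable def cubicSinc (w : ℝ) : ℝ := |normSincDeriv 0 w| ^ 3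

/-- The first derivative of `cubicSinc`. -/
noncomputable def cubicSincDeriv (w : ℝ) : ℝ :=
  3 * (normSincDeriv 0 w * |normSincDeriv 0 w|) * normSincDeriv 1 w

/-- The smooth factor of the second derivative of `cubicSinc`. -/
noncomputable def cubicSincFactor (w : ℝ) : ℝ :=
  6 * normSincDeriv 1 w ^ 2 + 3 * normSincDeriv 0 w * normSincDeriv 2 w

/-- The second derivative of `cubicSinc`. -/
noncomputable def cubicSincDerivTwo (w : ℝ) : ℝ := |normSincDeriv 0 w| * cubicSincFactor w

theorem continuous_cubicSinc : Continuous cubicSinc := by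
  have := continuous_normSincDeriv 0
  unfold cubicSinc; fun_prop

theorem continuous_cubicSincDeriv : Continuous cubicSincDeriv := by
  have := continuous_normSincDeriv 0
  have := continuous_normSincDeriv 1
  unfold cubicSincDeriv; fun_prop

theorem continuous_cubicSincDerivTwo : Continuous cubicSincDerivTwo := by
  have := continuous_normSincDeriv 0
  have := continuous_normSincDeriv 1
  have := continuous_normSincDeriv 2
  unfold cubicSincDerivTwo cubicSincFactor; fun_prop

theorem hasDerivAt_cubicSinc (w : ℝ) : HasDerivAt cubicSinc (cubicSincDeriv w) w := by
  have h : cubicSinc = fun w => normSincDeriv 0 w * (normSincDeriv 0 w * |normSincDeriv 0 w|) := by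
    funext w
    rw [cubicSinc, ← mul_assoc, ← pow_two, ← sq_abs]
    ring
  rw [h]
  have d := hasDerivAt_normSincDeriv 0 w
  refine (d.mul ((hasDerivAt_mul_abs _).comp w d)).congr_deriv ?_
  rw [cubicSincDeriv]
  simp only [Function.comp_apply]
  ring

theorem hasDerivAt_cubicSincDeriv (w : ℝ) :
    HasDerivAt cubicSincDeriv (cubicSincDerivTwo w) w := by
  have d := hasDerivAt_normSincDeriv 0 w
  refine ((((hasDerivAt_mul_abs _).comp w d).const_mul 3).mul
    (hasDerivAt_normSincDeriv 1 w)).congr_deriv ?_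
  rw [cubicSincDerivTwo, cubicSincFactor]
  simp only [Function.comp_apply]
  ring

theorem hasDerivAt_cubicSincFactor (w : ℝ) : HasDerivAt cubicSincFactor
    (15 * normSincDeriv 1 w * normSincDeriv 2 w + 3 * normSincDeriv 0 w * normSincDeriv 3 w) w := by
  have d0 := hasDerivAt_normSincDeriv 0 w
  have d1 := hasDerivAt_normSincDeriv 1 w
  have d2 := hasDerivAt_normSincDeriv 2 w
  refine (((d1.pow 2).const_mul 6).add ((d0.const_mul 3).mul d2)).congr_deriv ?_
  norm_num
  ring

theorem exists_cubicSinc_bounds : ∃ D : ℝ, 0 ≤ D ∧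
    (∀ w, |cubicSinc w| ≤ D * (1 + |w|) ^ (-2 : ℝ)) ∧
    (∀ w, |cubicSincDeriv w| ≤ D * (1 + |w|) ^ (-2 : ℝ)) ∧
    (∀ w, |cubicSincDerivTwo w| ≤ D * (1 + |w|) ^ (-2 : ℝ)) ∧
    ∀ w h, |h| ≤ 1 →
      |cubicSincDerivTwo w - cubicSincDerivTwo (w + h)| ≤ D * |h| * (1 + |w|) ^ (-2 : ℝ) := by
  obtain ⟨M, hM, hb⟩ := exists_abs_normSincDeriv_le
  have hr : ∀ w : ℝ, (1 + |w|) ^ (-2 : ℝ) = (1 + |w|)⁻¹ ^ 2 := fun w => by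
    rw [Real.rpow_neg (by positivity), Real.rpow_two, inv_pow]
  have r0 : ∀ w : ℝ, 0 ≤ (1 + |w|)⁻¹ := fun w => by positivity
  have r1 : ∀ w : ℝ, (1 + |w|)⁻¹ ≤ 1 := fun w =>
    inv_le_one_of_one_le₀ (by linarith [abs_nonneg w])
  have hbM : ∀ k ≤ 3, ∀ w, |normSincDeriv k w| ≤ M := fun k hk w =>
    (hb k hk w).trans (mul_le_of_le_one_right (by linarith) (r1 w))
  have hprod : ∀ k ≤ 3, ∀ l ≤ 3, ∀ w,
      |normSincDeriv k w| * |normSincDeriv l w| ≤ M ^ 2 * (1 + |w|)⁻¹ ^ 2 := by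
    intro k hk l hl w
    calc _ ≤ (M * (1 + |w|)⁻¹) * (M * (1 + |w|)⁻¹) := by
          gcongr
          · exact hb k hk w
          · exact hb l hl w
      _ = _ := by ring
  have hA : ∀ w, |cubicSincFactor w| ≤ 9 * M ^ 2 * (1 + |w|)⁻¹ ^ 2 := by
    intro w
    have h1 := hprod 1 (by norm_num) 1 (by norm_num) w
    have h2 := hprod 0 (by norm_num) 2 (by norm_num) w
    calc |cubicSincFactor w| ≤ |6 * normSincDeriv 1 w ^ 2| +
          |3 * normSincDeriv 0 w * normSincDeriv 2 w| := abs_add_le _ _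
      _ = 6 * (|normSincDeriv 1 w| * |normSincDeriv 1 w|) +
          3 * (|normSincDeriv 0 w| * |normSincDeriv 2 w|) := by
        simp only [abs_mul, abs_pow, abs_of_pos (show (0 : ℝ) < 6 by norm_num),
          abs_of_pos (show (0 : ℝ) < 3 by norm_num)]
        ring
      _ ≤ _ := by linarith
  have hA' : ∀ w, |15 * normSincDeriv 1 w * normSincDeriv 2 w +
      3 * normSincDeriv 0 w * normSincDeriv 3 w| ≤ 18 * M ^ 2 * (1 + |w|)⁻¹ ^ 2 := by
    intro w
    have h1 := hprod 1 (by norm_num) 2 (by norm_num) w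
    have h2 := hprod 0 (by norm_num) 3 (by norm_num) w
    calc _ ≤ |15 * normSincDeriv 1 w * normSincDeriv 2 w| +
          |3 * normSincDeriv 0 w * normSincDeriv 3 w| := abs_add_le _ _
      _ = 15 * (|normSincDeriv 1 w| * |normSincDeriv 2 w|) +
          3 * (|normSincDeriv 0 w| * |normSincDeriv 3 w|) := by
        simp only [abs_mul, abs_of_pos (show (0 : ℝ) < 15 by norm_num),
          abs_of_pos (show (0 : ℝ) < 3 by norm_num)]
        ring
      _ ≤ _ := by linarith
  have hshift : ∀ w u : ℝ, |u - w| ≤ 1 → (1 + |u|)⁻¹ ≤ 2 * (1 + |w|)⁻¹ := by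
    intro w u hu
    have h1 : |w| ≤ |u| + 1 := by
      have := abs_sub_abs_le_abs_sub w u
      rw [abs_sub_comm] at this
      linarith
    rw [← div_eq_mul_inv, le_div_iff₀ (by positivity), inv_mul_le_iff₀ (by positivity)]
    linarith [abs_nonneg u]
  refine ⟨108 * M ^ 3, by positivity, fun w => ?_, fun w => ?_, fun w => ?_, fun w h hh => ?_⟩
  all_goals rw [hr w]
  · have h1 := hprod 0 (by norm_num) 0 (by norm_num) w
    calc |cubicSinc w| = |normSincDeriv 0 w| * (|normSincDeriv 0 w| * |normSincDeriv 0 w|) := by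
          rw [cubicSinc, abs_pow, abs_abs]; ring
      _ ≤ M * (M ^ 2 * (1 + |w|)⁻¹ ^ 2) := by gcongr; exact hbM 0 (by norm_num) w
      _ = 1 * M ^ 3 * (1 + |w|)⁻¹ ^ 2 := by ring
      _ ≤ _ := by gcongr; norm_num
  · have h1 := hprod 0 (by norm_num) 1 (by norm_num) w
    calc |cubicSincDeriv w| =
          3 * (|normSincDeriv 0 w| * (|normSincDeriv 0 w| * |normSincDeriv 1 w|)) := by
          rw [cubicSincDeriv, abs_mul, abs_mul, abs_mul, abs_abs,
            abs_of_pos (show (0 : ℝ) < 3 by norm_num)]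
          ring
      _ ≤ 3 * (M * (M ^ 2 * (1 + |w|)⁻¹ ^ 2)) := by gcongr; exact hbM 0 (by norm_num) w
      _ = 3 * M ^ 3 * (1 + |w|)⁻¹ ^ 2 := by ring
      _ ≤ _ := by gcongr; norm_num
  · calc |cubicSincDerivTwo w| = |normSincDeriv 0 w| * |cubicSincFactor w| := by
          rw [cubicSincDerivTwo, abs_mul, abs_abs]
      _ ≤ M * (9 * M ^ 2 * (1 + |w|)⁻¹ ^ 2) := by
          gcongr
          · exact hbM 0 (by norm_num) w
          · exact hA w
      _ = 9 * M ^ 3 * (1 + |w|)⁻¹ ^ 2 := by ring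
      _ ≤ _ := by gcongr; norm_num
  · have hu : ∀ u : ℝ, |u - w| ≤ 1 → (1 + |u|)⁻¹ ^ 2 ≤ 4 * (1 + |w|)⁻¹ ^ 2 := fun u hu => by
      calc (1 + |u|)⁻¹ ^ 2 ≤ (2 * (1 + |w|)⁻¹) ^ 2 := by gcongr; exact hshift w u hu
        _ = _ := by ring
    have m1 : |cubicSincFactor w - cubicSincFactor (w + h)| ≤
        72 * M ^ 2 * (1 + |w|)⁻¹ ^ 2 * |h| := by
      have := (convex_closedBall w 1).norm_image_sub_le_of_norm_hasDerivWithin_le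
        (f := cubicSincFactor) (C := 72 * M ^ 2 * (1 + |w|)⁻¹ ^ 2)
        (fun u _ => (hasDerivAt_cubicSincFactor u).hasDerivWithinAt) (fun u hu' => by
          rw [Metric.mem_closedBall, Real.dist_eq] at hu'
          have := hu u hu'
          calc _ ≤ 18 * M ^ 2 * (1 + |u|)⁻¹ ^ 2 := hA' u
            _ ≤ 18 * M ^ 2 * (4 * (1 + |w|)⁻¹ ^ 2) := by gcongr
            _ = _ := by ring)
        (x := w + h) (y := w) (by simpa [Real.dist_eq] using hh) (by simp)
      simpa using this
    have m2 : |normSincDeriv 0 w - normSincDeriv 0 (w + h)| ≤ M * |h| := by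
      have := convex_univ.norm_image_sub_le_of_norm_hasDerivWithin_le
        (f := normSincDeriv 0) (C := M)
        (fun u _ => (hasDerivAt_normSincDeriv 0 u).hasDerivWithinAt)
        (fun u _ => hbM 1 (by norm_num) u)
        (x := w + h) (y := w) (Set.mem_univ _) (Set.mem_univ _)
      simpa using this
    have m3 : |cubicSincFactor (w + h)| ≤ 36 * M ^ 2 * (1 + |w|)⁻¹ ^ 2 := by
      have := hu (w + h) (by simpa using hh)
      calc _ ≤ 9 * M ^ 2 * (1 + |w + h|)⁻¹ ^ 2 := hA _
        _ ≤ 9 * M ^ 2 * (4 * (1 + |w|)⁻¹ ^ 2) := by gcongr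
        _ = _ := by ring
    calc |cubicSincDerivTwo w - cubicSincDerivTwo (w + h)|
        = |(|normSincDeriv 0 w| - |normSincDeriv 0 (w + h)|) * cubicSincFactor (w + h) +
            |normSincDeriv 0 w| * (cubicSincFactor w - cubicSincFactor (w + h))| := by
          rw [cubicSincDerivTwo, cubicSincDerivTwo]; ring_nf
      _ ≤ |normSincDeriv 0 w - normSincDeriv 0 (w + h)| * |cubicSincFactor (w + h)| +
            |normSincDeriv 0 w| * |cubicSincFactor w - cubicSincFactor (w + h)| := by
          refine (abs_add_le _ _).trans ?_
          rw [abs_mul, abs_mul, abs_abs]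
          exact add_le_add_left (mul_le_mul_of_nonneg_right
            (abs_abs_sub_abs_le (normSincDeriv 0 w) (normSincDeriv 0 (w + h))) (abs_nonneg _)) _
      _ ≤ M * |h| * (36 * M ^ 2 * (1 + |w|)⁻¹ ^ 2) + M * (72 * M ^ 2 * (1 + |w|)⁻¹ ^ 2 * |h|) := by
          gcongr
          exact hbM 0 (by norm_num) w
      _ = _ := by ring

open MeasureTheory in
theorem integrable_one_add_abs_rpow_neg_two :
    Integrable fun w : ℝ => (1 + |w|) ^ (-2 : ℝ) := by
  simpa using integrable_one_add_norm (E := ℝ) (μ := volume) (r := 2) (by simp)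

open MeasureTheory in
theorem integrable_cubicSinc : Integrable cubicSinc := by
  obtain ⟨D, _, h, _, _, _⟩ := exists_cubicSinc_bounds
  exact (integrable_one_add_abs_rpow_neg_two.const_mul D).mono'
    continuous_cubicSinc.aestronglyMeasurable (Filter.Eventually.of_forall h)

open MeasureTheory in
theorem integrable_cubicSincDeriv : Integrable cubicSincDeriv := by
  obtain ⟨D, _, _, h, _, _⟩ := exists_cubicSinc_bounds
  exact (integrable_one_add_abs_rpow_neg_two.const_mul D).mono'
    continuous_cubicSincDeriv.aestronglyMeasurable (Filter.Eventually.of_forall h)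

open MeasureTheory in
theorem integrable_cubicSincDerivTwo : Integrable cubicSincDerivTwo := by
  obtain ⟨D, _, _, _, h, _⟩ := exists_cubicSinc_bounds
  exact (integrable_one_add_abs_rpow_neg_two.const_mul D).mono'
    continuous_cubicSincDerivTwo.aestronglyMeasurable (Filter.Eventually.of_forall h)

open FourierTransform in
theorem fourier_cubicSincDeriv (x : ℝ) :
    𝓕 (fun w => (cubicSincDeriv w : ℂ)) x =
      2 * Real.pi * Complex.I * x * 𝓕 (fun w => (cubicSinc w : ℂ)) x := by
  have hd : deriv (fun w => (cubicSinc w : ℂ)) = fun w => (cubicSincDeriv w : ℂ) :=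
    funext fun w => (hasDerivAt_cubicSinc w).ofReal_comp.deriv
  have := Real.fourier_deriv (f := fun w => (cubicSinc w : ℂ)) integrable_cubicSinc.ofReal
    (fun w => (hasDerivAt_cubicSinc w).ofReal_comp.differentiableAt)
    (by rw [hd]; exact integrable_cubicSincDeriv.ofReal)
  rw [hd] at this
  simp only [this, smul_eq_mul]

open FourierTransform in
theorem fourier_cubicSincDerivTwo (x : ℝ) :
    𝓕 (fun w => (cubicSincDerivTwo w : ℂ)) x =
      2 * Real.pi * Complex.I * x * 𝓕 (fun w => (cubicSincDeriv w : ℂ)) x := by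
  have hd : deriv (fun w => (cubicSincDeriv w : ℂ)) = fun w => (cubicSincDerivTwo w : ℂ) :=
    funext fun w => (hasDerivAt_cubicSincDeriv w).ofReal_comp.deriv
  have := Real.fourier_deriv (f := fun w => (cubicSincDeriv w : ℂ)) integrable_cubicSincDeriv.ofReal
    (fun w => (hasDerivAt_cubicSincDeriv w).ofReal_comp.differentiableAt)
    (by rw [hd]; exact integrable_cubicSincDerivTwo.ofReal)
  rw [hd] at this
  simp only [this, smul_eq_mul]

open FourierTransform MeasureTheory in
theorem exists_norm_fourier_cubicSinc_le : ∃ C : ℝ, 0 ≤ C ∧ ∀ x : ℝ, 1 ≤ |x| →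
    ‖𝓕 (fun w => (cubicSinc w : ℂ)) x‖ ≤ C * (1 / |x| ^ (3 : ℝ)) := by
  obtain ⟨D, hD, _, _, _, h⟩ := exists_cubicSinc_bounds
  set B := ∫ w : ℝ, (1 + |w|) ^ (-2 : ℝ) with hB
  have hB0 : 0 ≤ B := integral_nonneg fun w => by positivity
  refine ⟨D * B, by positivity, fun x hx => ?_⟩
  have hx0 : x ≠ 0 := by rintro rfl; norm_num at hx
  have hx1 : 0 < |x| := abs_pos.2 hx0
  have e1 : ‖𝓕 (fun w => (cubicSincDerivTwo w : ℂ)) x‖ ≤ D * B * (1 / |x|) := by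
    rw [Real.fourier_eq, fourierIntegral_eq_half_sub_half_period_translate hx0
      integrable_cubicSincDerivTwo.ofReal]
    set s : ℝ := (1 / (2 * ‖x‖ ^ 2) : ℝ) • x with hs
    have hs' : |s| = 1 / (2 * |x|) := by
      rw [hs, smul_eq_mul, abs_mul, abs_of_pos (by positivity), Real.norm_eq_abs]
      field_simp
    have hs1 : |s| ≤ 1 := by
      rw [hs', div_le_one (by positivity)]; linarith
    have hs2 : |s| ≤ 1 / |x| := by
      rw [hs']; gcongr; linarith
    have hb : ∀ w : ℝ, ‖Real.fourierChar (-inner ℝ w x) •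
        ((cubicSincDerivTwo w : ℂ) - (cubicSincDerivTwo (w + s) : ℂ))‖ ≤
        D * |s| * (1 + |w|) ^ (-2 : ℝ) := fun w => by
      rw [Circle.norm_smul, ← Complex.ofReal_sub, Complex.norm_real]
      exact h w s hs1
    have := norm_integral_le_of_norm_le (integrable_one_add_abs_rpow_neg_two.const_mul (D * |s|))
      (Filter.Eventually.of_forall hb)
    rw [integral_const_mul, ← hB] at this
    rw [norm_smul]
    have h2 : ‖(1 / 2 : ℂ)‖ ≤ 1 := by norm_num
    calc _ ≤ 1 * (D * |s| * B) := by gcongr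
      _ ≤ 1 * (D * (1 / |x|) * B) := by gcongr
      _ = _ := by ring
  rw [fourier_cubicSincDerivTwo, fourier_cubicSincDeriv] at e1
  simp only [norm_mul, Complex.norm_I, Complex.norm_real, Complex.norm_ofNat, mul_one,
    Real.norm_eq_abs, abs_of_pos Real.pi_pos] at e1
  rw [show (3 : ℝ) = (3 : ℕ) by norm_num, Real.rpow_natCast]
  have hπ : 1 ≤ 2 * Real.pi := by linarith [Real.pi_gt_three]
  have e2 : |x| ^ 2 * ‖𝓕 (fun w => (cubicSinc w : ℂ)) x‖ ≤ D * B * (1 / |x|) := by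
    refine le_trans ?_ e1
    have : 1 ≤ (2 * Real.pi) ^ 2 := one_le_pow₀ hπ
    calc _ = 1 * (|x| ^ 2 * ‖𝓕 (fun w => (cubicSinc w : ℂ)) x‖) := by ring
      _ ≤ (2 * Real.pi) ^ 2 * (|x| ^ 2 * ‖𝓕 (fun w => (cubicSinc w : ℂ)) x‖) := by gcongr
      _ = _ := by ring
  have : D * B * (1 / |x| ^ 3) = D * B * (1 / |x|) / |x| ^ 2 := by field_simp
  rw [this, le_div_iff₀ (by positivity)]
  linarith

theorem cubicSinc_neg (w : ℝ) : cubicSinc (-w) = cubicSinc w := by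
  rw [cubicSinc, normSincDeriv_zero_neg, cubicSinc]

open FourierTransform MeasureTheory Set in
theorem ofReal_quasiLagrange (x : ℝ) :
    (quasiLagrange x : ℂ) = 𝓕 (fun w => (cubicSinc w : ℂ)) x := by
  have hπ := Real.pi_ne_zero
  have h1 : quasiLagrange x = ∫ w : ℝ, Real.cos (2 * Real.pi * w * x) * cubicSinc w := by
    have hsub := integral_comp_mul_left_Ioi
      (fun ξ => Real.cos (ξ * x) * oddSymbol ξ / ξ ^ 3) 0 (mul_pos two_pos Real.pi_pos)
    rw [mul_zero, smul_eq_mul] at hsub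
    have heq : ∫ ξ in Ioi 0, Real.cos (ξ * x) * oddSymbol ξ / ξ ^ 3 =
        2 * Real.pi * ∫ w in Ioi (0 : ℝ), Real.cos (2 * Real.pi * w * x) *
          oddSymbol (2 * Real.pi * w) / (2 * Real.pi * w) ^ 3 := by
      rw [hsub, mul_inv_cancel_left₀ (mul_ne_zero two_ne_zero hπ)]
    have habs := integral_comp_abs
      (f := fun w => Real.cos (2 * Real.pi * w * x) * cubicSinc w)
    have habs' : ∀ w : ℝ, Real.cos (2 * Real.pi * |w| * x) * cubicSinc |w| =
        Real.cos (2 * Real.pi * w * x) * cubicSinc w := by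
      intro w
      rcases abs_choice w with h | h <;> rw [h]
      rw [cubicSinc_neg,
        show 2 * Real.pi * -w * x = -(2 * Real.pi * w * x) by ring, Real.cos_neg]
    simp only [habs'] at habs
    rw [quasiLagrange_eq_integral, heq, habs, ← mul_assoc,
      show Real.pi⁻¹ * (2 * Real.pi) = 2 by field_simp]
    congr 1
    refine setIntegral_congr_fun measurableSet_Ioi fun w hw => ?_
    have hw' : (0 : ℝ) < w := hw
    have hS : normSincDeriv 0 w = Real.sin (Real.pi * w) / (Real.pi * w) := by
      rw [eq_div_iff (by positivity), mul_comm, mul_assoc, mul_normSincDeriv_zero]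
      field_simp
    rw [cubicSinc, hS, oddSymbol_eq_abs_sin, abs_div, abs_of_pos (mul_pos Real.pi_pos hw'),
      show 2 * Real.pi * w / 2 = Real.pi * w by ring]
    field_simp
    ring
  set F : ℝ → ℂ := fun v => Complex.exp (↑(-2 * Real.pi * v * x) * Complex.I) * cubicSinc v with hF
  have hFi : Integrable F := by
    refine (integrable_cubicSinc.ofReal (𝕜 := ℂ)).bdd_mul (c := 1)
      (Continuous.aestronglyMeasurable (by fun_prop)) (Filter.Eventually.of_forall fun v => ?_)
    rw [Complex.norm_exp_ofReal_mul_I]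
  have h2 : 𝓕 (fun w => (cubicSinc w : ℂ)) x = ∫ v, F v := by
    rw [Real.fourier_eq']
    refine integral_congr_ae (Filter.Eventually.of_forall fun v => ?_)
    simp only [hF, smul_eq_mul, RCLike.inner_apply, conj_trivial]
    congr 4
    ring
  have h3 : ∫ v, F v + F (-v) = 2 * ∫ v, F v := by
    rw [integral_add hFi hFi.comp_neg, integral_neg_eq_self]
    ring
  have h4 : ∀ v, F v + F (-v) = ((2 * (Real.cos (2 * Real.pi * v * x) * cubicSinc v) : ℝ) : ℂ) := by
    intro v
    simp only [hF]
    rw [cubicSinc_neg,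
      show -2 * Real.pi * v * x = -(2 * Real.pi * v * x) by ring,
      show -2 * Real.pi * -v * x = 2 * Real.pi * v * x by ring]
    push_cast
    rw [Complex.cos]
    ring
  simp only [h4] at h3
  rw [integral_complex_ofReal, integral_const_mul, ← h1] at h3
  push_cast at h3
  rw [h2]
  exact mul_left_cancel₀ two_ne_zero h3

theorem quasiLagrange_neg (x : ℝ) : quasiLagrange (-x) = quasiLagrange x := by
  simp [quasiLagrange_eq_integral]

theorem exists_abs_quasiLagrange_le : ∃ C : ℝ, 0 ≤ C ∧ ∀ x : ℝ, 1 ≤ |x| →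
    |quasiLagrange x| ≤ C * (1 / |x| ^ (3 : ℝ)) := by
  obtain ⟨C, hC, h⟩ := exists_norm_fourier_cubicSinc_le
  refine ⟨C, hC, fun x hx => ?_⟩
  have := h x hx
  rwa [← ofReal_quasiLagrange, Complex.norm_real] at this

theorem eventually_one_le_abs_intCast_sub (x : ℝ) :
    ∀ᶠ k : ℤ in Filter.cofinite, 1 ≤ |(k : ℝ) - x| := by
  have h : Filter.Tendsto (fun k : ℤ => |(k : ℝ) - x|) Filter.cofinite Filter.atTop := by
    have h1 := (Homeomorph.addRight (-x)).isClosedEmbedding.tendsto_cocompact.comp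
      Int.tendsto_coe_cofinite
    exact (tendsto_norm_cocompact_atTop.comp h1)
  exact h.eventually_ge_atTop 1

theorem summable_mul_quasiLagrange (x : ℝ) :
    Summable fun k : ℤ => ((k : ℝ) - x) * quasiLagrange (k - x) := by
  obtain ⟨C, hC, h⟩ := exists_abs_quasiLagrange_le
  refine Summable.of_norm_bounded_eventually
    (((Real.summable_one_div_int_add_rpow (-x) 2).2 one_lt_two).mul_left C) ?_
  filter_upwards [eventually_one_le_abs_intCast_sub x] with k hk
  have hk0 : 0 < |(k : ℝ) - x| := by linarith
  rw [norm_mul, Real.norm_eq_abs, Real.norm_eq_abs, ← sub_eq_add_neg]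
  calc _ ≤ |(k : ℝ) - x| * (C * (1 / |(k : ℝ) - x| ^ (3 : ℝ))) := by gcongr; exact h _ hk
    _ = _ := by
      rw [show (3 : ℝ) = 2 + 1 by norm_num, Real.rpow_add hk0, Real.rpow_one]
      field_simp

theorem summable_quasiLagrange (x : ℝ) : Summable fun k : ℤ => quasiLagrange (k - x) := by
  refine Summable.of_norm_bounded_eventually (summable_mul_quasiLagrange x).norm ?_
  filter_upwards [eventually_one_le_abs_intCast_sub x] with k hk
  rw [norm_mul]
  exact le_mul_of_one_le_left (norm_nonneg _) hk

open FourierTransform MeasureTheory in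
theorem fourier_exp_mul (G : ℝ → ℂ) (x y : ℝ) :
    𝓕 (fun w => Complex.exp (↑(2 * Real.pi * w * x) * Complex.I) * G w) y = 𝓕 G (y - x) := by
  rw [Real.fourier_eq', Real.fourier_eq']
  refine integral_congr_ae (Filter.Eventually.of_forall fun v => ?_)
  simp only [smul_eq_mul, ← mul_assoc, ← Complex.exp_add]
  congr 2
  simp
  ring

open FourierTransform MeasureTheory in
/-- Poisson summation, shifted by `x`, for functions decaying like `(1 + |w|) ^ (-2)`. -/
theorem tsum_exp_mul_eq_tsum_fourier {G : ℝ → ℂ} (hG : Continuous G) {D : ℝ}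
    (hD : ∀ w, ‖G w‖ ≤ D * (1 + |w|) ^ (-2 : ℝ)) (x : ℝ)
    (hs : Summable fun n : ℤ => 𝓕 G (n - x)) :
    ∑' n : ℤ, Complex.exp (↑(2 * Real.pi * n * x) * Complex.I) * G n =
      ∑' n : ℤ, 𝓕 G (n - x) := by
  have hO : (fun w : ℝ => Complex.exp (↑(2 * Real.pi * w * x) * Complex.I) * G w)
      =O[Filter.cocompact ℝ] fun w => |w| ^ (-2 : ℝ) := by
    refine Asymptotics.IsBigO.of_bound |D| ?_
    have : ∀ᶠ w : ℝ in Filter.cocompact ℝ, w ≠ 0 := by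
      have := (isCompact_singleton (x := (0 : ℝ))).compl_mem_cocompact
      filter_upwards [this] with w hw using hw
    filter_upwards [this] with w hw
    rw [norm_mul, Complex.norm_exp_ofReal_mul_I, one_mul,
      Real.norm_of_nonneg (Real.rpow_nonneg (abs_nonneg _) _)]
    calc ‖G w‖ ≤ D * (1 + |w|) ^ (-2 : ℝ) := hD w
      _ ≤ |D| * (1 + |w|) ^ (-2 : ℝ) := by gcongr; exact le_abs_self D
      _ ≤ |D| * |w| ^ (-2 : ℝ) := by
        gcongr ?_ * ?_
        exact Real.rpow_le_rpow_of_nonpos (abs_pos.2 hw) (by linarith) (by norm_num)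
  have key := Real.tsum_eq_tsum_fourier_of_rpow_decay_of_summable
    (f := fun w : ℝ => Complex.exp (↑(2 * Real.pi * w * x) * Complex.I) * G w)
    (by fun_prop) one_lt_two hO (by simpa only [fourier_exp_mul] using hs) 0
  simp only [fourier_exp_mul] at key
  simpa using key

open FourierTransform MeasureTheory in
theorem tsum_quasiLagrange (x : ℝ) : ∑' k : ℤ, quasiLagrange (k - x) = 1 := by
  obtain ⟨D, _, h, _⟩ := exists_cubicSinc_bounds
  have hs : Summable fun n : ℤ => 𝓕 (fun w => (cubicSinc w : ℂ)) (n - x) := by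
    simp only [← ofReal_quasiLagrange]
    exact_mod_cast summable_quasiLagrange x
  have key := tsum_exp_mul_eq_tsum_fourier (G := fun w => (cubicSinc w : ℂ))
    (Complex.continuous_ofReal.comp continuous_cubicSinc)
    (fun w => by rw [Complex.norm_real]; exact h w) x hs
  simp only [← ofReal_quasiLagrange] at key
  rw [tsum_eq_single 0 (fun n hn => by
    simp [cubicSinc, normSincDeriv_zero_intCast hn])] at key
  simp only [Int.cast_zero, cubicSinc, normSincDeriv_zero_zero] at key
  simp at key
  exact_mod_cast key.symm

open FourierTransform MeasureTheory in
theorem tsum_mul_quasiLagrange (x : ℝ) :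
    ∑' k : ℤ, ((k : ℝ) - x) * quasiLagrange (k - x) = 0 := by
  obtain ⟨D, _, _, h, _⟩ := exists_cubicSinc_bounds
  have hF : ∀ n : ℤ, 𝓕 (fun w => (cubicSincDeriv w : ℂ)) (n - x) =
      2 * Real.pi * Complex.I * ((((n : ℝ) - x) * quasiLagrange (n - x) : ℝ) : ℂ) := by
    intro n
    rw [fourier_cubicSincDeriv, ← ofReal_quasiLagrange]
    push_cast
    ring
  have hs : Summable fun n : ℤ => 𝓕 (fun w => (cubicSincDeriv w : ℂ)) (n - x) := by
    simp only [hF]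
    exact (Complex.ofRealCLM.summable (summable_mul_quasiLagrange x)).mul_left _
  have key := tsum_exp_mul_eq_tsum_fourier (G := fun w => (cubicSincDeriv w : ℂ))
    (Complex.continuous_ofReal.comp continuous_cubicSincDeriv)
    (fun w => by rw [Complex.norm_real]; exact h w) x hs
  have hzero : ∀ n : ℤ, cubicSincDeriv n = 0 := by
    intro n
    rcases eq_or_ne n 0 with rfl | hn
    · simp [cubicSincDeriv, normSincDeriv_one_zero]
    · simp [cubicSincDeriv, normSincDeriv_zero_intCast hn]
  simp only [hzero, hF, Complex.ofReal_zero, mul_zero, tsum_zero, tsum_mul_left] at key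
  have := (mul_eq_zero.1 key.symm).resolve_left Complex.two_pi_I_ne_zero
  exact_mod_cast this

theorem mainTheorem3 :
    (∀ x : ℝ, Summable fun j : ℤ => lam j * thinPlateSpline |x - j|) ∧
    ∀ p : ℝ[X], p.degree ≤ 1 → ∀ x : ℝ,
      HasSum (fun k : ℤ => p.eval (k : ℝ) * quasiLagrange (x - k)) (p.eval x) := by
  refine ⟨fun x => (hasSum_lam_mul_thinPlateSpline x).summable, fun p hp x => ?_⟩
  rw [eq_X_add_C_of_degree_le_one hp]
  have h0 := (summable_quasiLagrange x).hasSum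
  have h1 := (summable_mul_quasiLagrange x).hasSum
  rw [tsum_quasiLagrange] at h0
  rw [tsum_mul_quasiLagrange] at h1
  convert! (h0.mul_left (p.coeff 1 * x + p.coeff 0)).add (h1.mul_left (p.coeff 1)) using 1
  · funext k
    rw [← quasiLagrange_neg (x - k), neg_sub]
    simp only [eval_add, eval_mul, eval_C, eval_X]
    ring
  · simp
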